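/- **Conventions.** For a poset $P$, the height $\mathrm{Ht}(P)$ is the supremum (a cardinal number) of the cardinalities of chains in $P$. Let $S$ be a semigroup and $S^1$ its monoid completion. Green's relations on $S$ are given by $x\,\mathscr L\,y \iff S^1x=S^1y$, $x\,\mathscr R\,y\iff xS^1=yS^1$, $\mathscr H=\mathscr L\cap\mathscr R$, and $\mathscr D=\mathscr L\vee\mathscr R$ (the join in the lattice of equivalence relations on $S$). The $\mathscr L$-classes are partially ordered by $L_x\le L_y\iff x\in S^1y$. A left congruence on $S$ is an equivalence $\sigma$ on $S$ such that $(x,y)\in\sigma$ implies $(ax,ay)\in\sigma$ for all $a\in S$; $\mathrm{LCong}(S)$ is the lattice of left congruences ordered by inclusion. A minimal $\mathscr L$-class $L$ is closed under left multiplication by $S$, hence is a left $S$-act, denoted ${}^S\!L$; $\mathrm{Cong}({}^S\!L)$ is the lattice of equivalences on $L$ compatible with the action of every $s\in S$, and $\mathscr H_L$ is the restriction of $\mathscr H$ to $L$. A congruence $\sigma\neq\nabla$ is maximal if no congruence lies strictly between $\sigma$ and the universal relation $\nabla$. An $\mathscr L$-class $L$ is $\mathscr H$-separable if for all $x,y\in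 L$ with $(x,y)\notin\mathscr H$ there is $s\in S$ such that exactly one of $sx$, $sy$ belongs to $L$. The Schützenberger group of an $\mathscr H$-class $H$ is the group of all permutations of $H$ of the form $x\mapsto xt$ with $t\in S^1$, $Ht\subseteq H$. $\mathrm{Sub}(\Gamma)$ is the lattice of subgroups of a group $\Gamma$. **Theorem.** Let $S$ be a semigroup with finitely many $\mathscr L$-classes, let $L_1,\dots,L_n$ be representative $\mathscr L$-classes for the $\mathscr D$-classes of $S$ (each $\mathscr D$-class contains exactly one of them), with $L_1$ a minimal $\mathscr L$-class. For each $r$, let $m_r$ be the number of $\mathscr L$-classes in the $\mathscr D$-class of $L_r$, and let $\Gamma_r$ be the Schützenberger group of any $\mathscr H$-class contained in $L_r$. Suppose that $L_2,\dots,L_n$ are all $\mathscr H$-separable. Then $$\mathrm{Ht}(\mathrm{LCong}(S))=m_1\,\mathrm{Ht}(\mathrm{Cong}({}^S\!L_1))+\sum_{r=2}^n m_r\,\mathrm{Ht}(\mathrm{Sub}(\Gamma_r)).$$ Moreover: (i) If $L_1$ is an $\mathscr H$-class, then $\mathrm{Ht}(\mathrm{LCong}(S))=\sum_{r=1}^n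 m_r\,\mathrm{Ht}(\mathrm{Sub}(\Gamma_r))$. (ii) If $\mathscr H_{L_1}$ is the unique maximal congruence on ${}^S\!L_1$, then $$\mathrm{Ht}(\mathrm{LCong}(S))=m_1+\sum_{r=1}^n m_r\,\mathrm{Ht}(\mathrm{Sub}(\Gamma_r)),$$ where this equality holds in $\mathbb N\cup\{\infty\}$ (that is, after identifying all infinite cardinals with $\infty$); it holds as an equality of cardinals if, in addition, $\mathrm{Ht}(\mathrm{Sub}(\Gamma_1))$ is finite or every congruence on ${}^S\!L_1$ other than $\nabla$ is contained in $\mathscr H_{L_1}$. -/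

import Mathlib

open scoped Cardinal

namespace SgpHeight

universe u

/-- The height of a poset: the supremum, as a cardinal number, of the cardinalities of its
chains. (The supremum is over a small family, so it is never a default value.) -/
noncomputable def Ht (P : Type u) [PartialOrder P] : Cardinal.{u} :=
  ⨆ C : {C : Set P // IsChain (· ≤ ·) C}, #(C : Set P)

section Green

variable (S : Type u) [Semigroup S]

/-- Green's preorder `x ≤ y` for the relation `L`: `x ∈ S¹ y`. -/
def leL {S : Type u} [Semigroup S] (x y : S) : Prop := x = y ∨ ∃ s : S, x = s * y

/-- Green's preorder `x ≤ y` for the relation `R`: `x ∈ y S¹`. -/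
def leR {S : Type u} [Semigroup S] (x y : S) : Prop := x = y ∨ ∃ s : S, x = y * s

theorem leL_refl {S : Type u} [Semigroup S] (x : S) : leL x x := Or.inl rfl

theorem leR_refl {S : Type u} [Semigroup S] (x : S) : leR x x := Or.inl rfl

theorem leL_trans {S : Type u} [Semigroup S] {x y z : S} (h : leL x y) (k : leL y z) :
    leL x z := by
  rcases h with rfl | ⟨s, rfl⟩
  · exact k
  · rcases k with rfl | ⟨t, rfl⟩
    · exact Or.inr ⟨s, rfl⟩
    · exact Or.inr ⟨s * t, (mul_assoc s t z).symm⟩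

theorem leR_trans {S : Type u} [Semigroup S] {x y z : S} (h : leR x y) (k : leR y z) :
    leR x z := by
  rcases h with rfl | ⟨s, rfl⟩
  · exact k
  · rcases k with rfl | ⟨t, rfl⟩
    · exact Or.inr ⟨s, rfl⟩
    · exact Or.inr ⟨t * s, mul_assoc z t s⟩

/-- Green's relation `L`. -/
def greenL : Setoid S where
  r x y := leL x y ∧ leL y x
  iseqv := ⟨fun x => ⟨leL_refl x, leL_refl x⟩, fun h => ⟨h.2, h.1⟩,
    fun h k => ⟨leL_trans h.1 k.1, leL_trans k.2 h.2⟩⟩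

/-- Green's relation `R`. -/
def greenR : Setoid S where
  r x y := leR x y ∧ leR y x
  iseqv := ⟨fun x => ⟨leR_refl x, leR_refl x⟩, fun h => ⟨h.2, h.1⟩,
    fun h k => ⟨leR_trans h.1 k.1, leR_trans k.2 h.2⟩⟩

/-- Green's relation `H`, the intersection of `L` and `R`. -/
def greenH : Setoid S := greenL S ⊓ greenR S

/-- Green's relation `D`, the join of `L` and `R` in the lattice of equivalence relations. -/
def greenD : Setoid S := greenL S ⊔ greenR S

end Green

section Classes

variable {S : Type u} [Semigroup S]

/-- `K` is a minimal `L`-class: it is minimal in the poset of `L`-classes, which is ordered by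
`L_x ≤ L_y ↔ leL x y`. -/
def IsMinimalLClass (K : Set S) : Prop :=
  K ∈ (greenL S).classes ∧
    ∀ K' ∈ (greenL S).classes, (∃ x ∈ K', ∃ y ∈ K, leL x y) → K' = K

/-- The number of `L`-classes in the `D`-class that contains the `L`-class `K`. -/
noncomputable def numLClasses (K : Set S) : ℕ :=
  {K' | K' ∈ (greenL S).classes ∧ ∃ D ∈ (greenD S).classes, K ⊆ D ∧ K' ⊆ D}.ncard

/-- An `L`-class `K` is `H`-separable: any two elements of `K` which are not `H`-related are
separated by some `s ∈ S`, in the sense that exactly one of `s x`, `s y` lies in `K`. -/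
def HSeparable (K : Set S) : Prop :=
  ∀ x ∈ K, ∀ y ∈ K, ¬ greenH S x y → ∃ s : S, Xor (s * x ∈ K) (s * y ∈ K)

end Classes

section Schutzenberger

variable {S : Type u} [Semigroup S]

/-- The right action of `S¹` on `S`. (If `S` is already a monoid, the new identity of
`WithOne S` acts in the same way as the old one.) -/
def rmul (x : S) : WithOne S → S
  | none => x
  | some s => x * s

theorem rmul_rmul (x : S) (s t : WithOne S) : rmul (rmul x s) t = rmul x (s * t) := by
  cases s <;> cases t
  · rfl
  · rfl
  · rfl
  · exact mul_assoc _ _ _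

theorem mul_rmul (s x : S) (t : WithOne S) : s * rmul x t = rmul (s * x) t := by
  cases t
  · rfl
  · exact (mul_assoc _ _ _).symm

/-- If `H t ⊆ H` for an `H`-class `H`, then right translation by `t` on `H` is undone by right
translation by some `t'`. -/
theorem exists_right_inverse {H : Set S} (hH : H ∈ (greenH S).classes) {t : WithOne S}
    (ht : ∀ x ∈ H, rmul x t ∈ H) :
    ∃ t' : WithOne S, ∀ x ∈ H, rmul (rmul x t) t' = x := by
  obtain ⟨h, rfl⟩ := hH
  have h0 : h ∈ {x | greenH S x h} := (greenH S).refl' h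
  have h1 : greenH S (rmul h t) h := ht h h0
  have h2 : ∃ t' : WithOne S, rmul (rmul h t) t' = h := by
    rcases h1.2.2 with e | ⟨s, e⟩
    · exact ⟨1, e.symm⟩
    · exact ⟨(s : WithOne S), e.symm⟩
  obtain ⟨t', ht'⟩ := h2
  refine ⟨t', fun x hx => ?_⟩
  have hx' : greenH S x h := hx
  rcases hx'.1.1 with rfl | ⟨s, rfl⟩
  · exact ht'
  · rw [← mul_rmul, ← mul_rmul, ht']

/-- The Schützenberger group of an `H`-class `H`: the group of all permutations of `H` of the
form `x ↦ x t`, where `t ∈ S¹` satisfies `H t ⊆ H`, under composition. (By Green's Lemma every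
`t ∈ S¹` with `H t ⊆ H` induces a permutation of `H`.) -/
def schutzenberger (H : Set S) (hH : H ∈ (greenH S).classes) : Subgroup (Equiv.Perm H) where
  carrier := {α | ∃ t : WithOne S, ∀ x : H, (α x : S) = rmul (x : S) t}
  mul_mem' := by
    rintro α β ⟨s, hs⟩ ⟨t, ht⟩
    refine ⟨t * s, fun x => ?_⟩
    rw [Equiv.Perm.mul_apply, hs, ht, rmul_rmul]
  one_mem' := ⟨1, fun _ => rfl⟩
  inv_mem' := by
    rintro α ⟨t, ht⟩
    obtain ⟨t', ht'⟩ := exists_right_inverse hH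
      (t := t) (fun x hx => by rw [← ht ⟨x, hx⟩]; exact (α ⟨x, hx⟩).2)
    refine ⟨t', fun x => ?_⟩
    have h := ht (α⁻¹ x)
    rw [show α (α⁻¹ x) = x from Equiv.apply_symm_apply α x] at h
    rw [h]
    exact (ht' _ (α⁻¹ x).2).symm

end Schutzenberger

section Congruences

/-- An equivalence relation on `S` is a left congruence if it is compatible with left
multiplication. -/
def IsLeftCong {S : Type u} [Semigroup S] (σ : Setoid S) : Prop :=
  ∀ a x y : S, σ x y → σ (a * x) (a * y)

/-- The poset (lattice) `LCong(S)` of left congruences of `S`, ordered by inclusion. -/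
abbrev LCong (S : Type u) [Semigroup S] : Type u := {σ : Setoid S // IsLeftCong σ}

/-- An equivalence relation on a left `S`-act `A` is a congruence if it is compatible with the
action of every element of `S`. -/
def IsActCong (S : Type u) {A : Type u} [Semigroup S] [SMul S A] (σ : Setoid A) : Prop :=
  ∀ (s : S) (x y : A), σ x y → σ (s • x) (s • y)

/-- The poset (lattice) `Cong(A)` of congruences of a left `S`-act `A`, ordered by inclusion. -/
abbrev ActCong (S A : Type u) [Semigroup S] [SMul S A] : Type u :=
  {σ : Setoid A // IsActCong S σ}

/-- `σ` is a maximal congruence of the `S`-act `A`: a congruence different from the universal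
one, with no congruence strictly between it and the universal one. -/
def IsMaximalActCong (S : Type u) {A : Type u} [Semigroup S] [SMul S A] (σ : Setoid A) : Prop :=
  IsActCong S σ ∧ σ ≠ ⊤ ∧ ¬ ∃ τ : Setoid A, IsActCong S τ ∧ σ < τ ∧ τ < ⊤

variable {S : Type u} [Semigroup S]

/-- A minimal `L`-class `K`, as a left `S`-act under left multiplication. -/
def minAct (K : Set S) (hK : IsMinimalLClass K) : SubMulAction S S where
  carrier := K
  smul_mem' := by
    intro s x hx
    have h := hK.2 {z | greenL S z (s * x)} ((greenL S).mem_classes (s * x))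
      ⟨s * x, (greenL S).refl' _, x, hx, Or.inr ⟨s, rfl⟩⟩
    have h' : s * x ∈ {z | greenL S z (s * x)} := (greenL S).refl' _
    rw [h] at h'
    exact h'

/-- The restriction of Green's relation `H` to a minimal `L`-class. -/
def restrictH (K : Set S) (hK : IsMinimalLClass K) : Setoid (minAct K hK) :=
  (greenH S).comap Subtype.val

/-- `H_K` is the unique maximal congruence of the act formed by the minimal `L`-class `K`. -/
def RestrictHUniqueMaximal (K : Set S) (hK : IsMinimalLClass K) : Prop :=
  IsMaximalActCong S (restrictH K hK) ∧
    ∀ σ : Setoid (minAct K hK), IsMaximalActCong S σ → σ = restrictH K hK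

end Congruences

end SgpHeight

open SgpHeight

/-!
Each `L`-class `K` of `S` contributes to `Ht (LCong S)` the height of one poset, `PartialCong K`:
the equivalences on `K` compatible with the partial left action of `S` on `K`. Together with a
greatest element these are the congruences on the act `K ∪ {0}`.

The contributions add up (`Ht_LCong_eq_sum`). Starting from the minimal `L`-class, the semigroup is
exhausted by left ideals, one `L`-class being added at each step. Let `I` be a left ideal and
`I ∪ K` the next one. Of two comparable left congruences, if they have the same part inside `I`,
relate `K` to `I` both or neither, and in the latter case agree on `K`, then they are equal. As a
chain in a product of two posets is no longer than the sum of the heights less one, this gives one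
inequality (`LCongOn.Ht_union_le`); a chain below the Rees congruence of `I`, followed by a chain
above it, gives the other (`LCongOn.le_Ht_union`). All of this holds for infinite cardinals too.

By Green's Lemma, `L`-classes in the same `D`-class are matched by right translations, which
commute with the left action, so they contribute equally (`Ht_LCong_eq_sum_representatives`).

It remains to identify the contributions of the representatives. On a minimal `L`-class the action
is total and `PartialCong K` is the congruence lattice of the act (`actCongOrderIso`). On any
`L`-class the partial congruences inside `H` are the orbit relations of the subgroups of the
Schützenberger group (`orbitCongOrderIso`), and if `K` is `H`-separable, in particular if `K` is an
`H`-class, then every partial congruence lies inside `H` (`HSeparable.le_greenH`).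

If finally `H` is the unique maximal congruence on the minimal `L`-class and the subgroup lattice
has finite height, then all congruences but the universal one lie inside `H`
(`le_restrictH_of_finite`), so that the height of the congruence lattice exceeds that of the
subgroup lattice by one. If the latter is infinite, then so are both sides of the equation.
-/

open scoped Cardinal

namespace SgpHeight

universe u

/-! ### Heights of posets -/

section Height

variable {P Q A B : Type u} [PartialOrder P] [PartialOrder Q] [PartialOrder A] [PartialOrder B]

theorem mk_le_Ht {C : Set P} (hC : IsChain (· ≤ ·) C) : #C ≤ Ht P :=
  le_ciSup (f := fun C : {C : Set P // IsChain (· ≤ ·) C} => #(C : Set P))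
    Cardinal.bddAbove_of_small ⟨C, hC⟩

theorem Ht_le {c : Cardinal.{u}} (h : ∀ C : Set P, IsChain (· ≤ ·) C → #C ≤ c) : Ht P ≤ c :=
  ciSup_le' fun C => h C.1 C.2

theorem mk_le_Ht_of_injective {α : Type u} (g : α → P) (hg : Function.Injective g)
    (hc : ∀ a b, g a ≤ g b ∨ g b ≤ g a) : #α ≤ Ht P := by
  rw [← Cardinal.mk_range_eq g hg]
  apply mk_le_Ht
  rintro _ ⟨a, rfl⟩ _ ⟨b, rfl⟩ _
  exact hc a b

theorem Ht_le_of_orderEmbedding (e : P ↪o Q) : Ht P ≤ Ht Q := by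
  refine Ht_le fun C hC => mk_le_Ht_of_injective (fun c : C => e c)
    (e.injective.comp Subtype.val_injective) fun a b => ?_
  simpa using hC.total a.2 b.2

theorem Ht_congr (e : P ≃o Q) : Ht P = Ht Q :=
  le_antisymm (Ht_le_of_orderEmbedding e.toOrderEmbedding)
    (Ht_le_of_orderEmbedding e.symm.toOrderEmbedding)

theorem one_le_Ht [Nonempty P] : 1 ≤ Ht P := by
  obtain ⟨p⟩ := ‹Nonempty P›
  simpa using mk_le_Ht (IsChain.singleton (r := (· ≤ ·)) (a := p))

theorem Ht_add_Ht_le {c : Cardinal.{u}}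
    (h : ∀ (C : Set A) (D : Set B), IsChain (· ≤ ·) C → IsChain (· ≤ ·) D → #C + #D ≤ c) :
    Ht A + Ht B ≤ c := by
  have : Nonempty {C : Set A // IsChain (· ≤ ·) C} := ⟨⟨∅, IsChain.empty⟩⟩
  have : Nonempty {C : Set B // IsChain (· ≤ ·) C} := ⟨⟨∅, IsChain.empty⟩⟩
  unfold Ht
  rw [Cardinal.ciSup_add_ciSup _ Cardinal.bddAbove_of_small _ Cardinal.bddAbove_of_small]
  exact ciSup_le' fun C => ciSup_le' fun D => h C.1 D.1 C.2 D.2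

theorem Ht_add_le {a c : Cardinal.{u}} (h : ∀ C : Set P, IsChain (· ≤ ·) C → #C + a ≤ c) :
    Ht P + a ≤ c := by
  have : Nonempty {C : Set P // IsChain (· ≤ ·) C} := ⟨⟨∅, IsChain.empty⟩⟩
  unfold Ht
  rw [Cardinal.ciSup_add _ Cardinal.bddAbove_of_small]
  exact ciSup_le' fun C => h C.1 C.2

/-- Adjoining a new greatest element `t` to (a copy of) `Q` increases the height by one. -/
theorem Ht_eq_add_one (ι : Q ↪o P) (t : P) (ht : ∀ x, x ≤ t) (hι : ∀ q, ι q ≠ t)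
    (hsurj : ∀ x, x ≠ t → ∃ q, ι q = x) : Ht P = Ht Q + 1 := by
  apply le_antisymm
  · refine Ht_le fun C hC => ?_
    have hC' : IsChain (· ≤ ·) (ι ⁻¹' C) := fun a ha b hb _ => by
      simpa using hC.total ha hb
    have hsub : C ⊆ insert t (ι '' (ι ⁻¹' C)) := by
      intro x hx
      by_cases hxt : x = t
      · exact Or.inl hxt
      · obtain ⟨q, rfl⟩ := hsurj x hxt
        exact Or.inr ⟨q, hx, rfl⟩
    calc #C ≤ #(insert t (ι '' (ι ⁻¹' C)) : Set P) := Cardinal.mk_le_mk_of_subset hsub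
      _ ≤ #(ι '' (ι ⁻¹' C)) + 1 := Cardinal.mk_insert_le
      _ ≤ #(ι ⁻¹' C) + 1 := by gcongr; exact Cardinal.mk_image_le
      _ ≤ Ht Q + 1 := by gcongr; exact mk_le_Ht hC'
  · refine Ht_add_le fun C hC => ?_
    have h := mk_le_Ht_of_injective (α := Option C) (fun o => o.elim t fun q => ι q) ?_ ?_
    · simpa [Cardinal.mk_option] using h
    · rintro (_ | a) (_ | b) h
      · rfl
      · exact absurd h.symm (hι _)
      · exact absurd h (hι _)
      · exact congrArg some (Subtype.ext (ι.injective h))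
    · rintro (_ | a) (_ | b)
      · exact Or.inl (ht _)
      · exact Or.inr (ht _)
      · exact Or.inl (ht _)
      · simpa using hC.total a.2 b.2

theorem Ht_withTop : Ht (WithTop P) = Ht P + 1 :=
  Ht_eq_add_one WithTop.coeOrderHom ⊤ (fun _ => le_top) (fun _ => WithTop.coe_ne_top)
    fun x hx => ⟨x.untop hx, WithTop.coe_untop x hx⟩

/-- In a product of two finite chains with `a` and `b` elements, a chain has at most `a + b - 1`
elements: each step up the chain changes at least one coordinate. -/
theorem card_add_one_le_card_image [DecidableEq A] [DecidableEq B] (f : P → A) (g : P → B)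
    (hf : Monotone f) (hg : Monotone g)
    (hfg : ∀ x y, x ≤ y → f x = f y → g x = g y → x = y) (C : Finset P)
    (hC : IsChain (· ≤ ·) (C : Set P)) (hne : C.Nonempty) :
    C.card + 1 ≤ (C.image f).card + (C.image g).card := by
  classical
  induction hn : C.card generalizing C with
  | zero => simp_all
  | succ n ih =>
    obtain ⟨m, hm, hmax⟩ := C.exists_maximal hne
    have hgt : ∀ x ∈ C, x ≤ m := fun x hx => (hC.total hx hm).elim id fun h => hmax hx h
    set D := C.erase m with hD
    have hCD : C = insert m D := (Finset.insert_erase hm).symm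
    have hcard : D.card = n := by rw [hD, Finset.card_erase_of_mem hm, hn]; rfl
    rcases D.eq_empty_or_nonempty with h0 | hDne
    · have : n = 0 := by rw [← hcard, h0]; rfl
      rw [hCD, h0]; simp [this]
    · have hDC : D ⊆ C := Finset.erase_subset _ _
      have hDch := hC.mono (Finset.coe_subset.2 hDC)
      have key := ih D hDch hDne hcard
      obtain ⟨m', hm', hmax'⟩ := D.exists_maximal hDne
      have hgt' : ∀ x ∈ D, x ≤ m' := fun x hx => (hDch.total hx hm').elim id fun h => hmax' hx h
      have hm'm : m' ≤ m := hgt m' (hDC hm')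
      have hnew : f m ∉ D.image f ∨ g m ∉ D.image g := by
        by_contra! hcon
        obtain ⟨h1, h2⟩ := hcon
        obtain ⟨a, ha, hae⟩ := Finset.mem_image.1 h1
        obtain ⟨b, hb, hbe⟩ := Finset.mem_image.1 h2
        have e1 : f m' = f m := le_antisymm (hf hm'm) (hae ▸ hf (hgt' a ha))
        have e2 : g m' = g m := le_antisymm (hg hm'm) (hbe ▸ hg (hgt' b hb))
        exact (Finset.mem_erase.1 hm').1 (hfg _ _ hm'm e1 e2)
      have hle1 : (D.image f).card ≤ (C.image f).card :=
        Finset.card_le_card (Finset.image_subset_image hDC)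
      have hle2 : (D.image g).card ≤ (C.image g).card :=
        Finset.card_le_card (Finset.image_subset_image hDC)
      rcases hnew with h | h
      · have : (C.image f).card = (D.image f).card + 1 := by
          rw [hCD, Finset.image_insert, Finset.card_insert_of_notMem h]
        omega
      · have : (C.image g).card = (D.image g).card + 1 := by
          rw [hCD, Finset.image_insert, Finset.card_insert_of_notMem h]
        omega

/-- If monotone maps to `A` and `B` jointly separate comparable elements, then
the height of `P`, counted in steps, is at most the sum of those of `A` and `B`. -/
theorem Ht_add_one_le_of_separating [Nonempty A] [Nonempty B] (f : P → A) (g : P → B)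
    (hf : Monotone f) (hg : Monotone g)
    (hfg : ∀ x y, x ≤ y → f x = f y → g x = g y → x = y) : Ht P + 1 ≤ Ht A + Ht B := by
  classical
  refine Ht_add_le fun C hC => ?_
  have chf : IsChain (· ≤ ·) (f '' C) := by
    rintro _ ⟨a, ha, rfl⟩ _ ⟨b, hb, rfl⟩ _
    exact (hC.total ha hb).imp (fun h => hf h) fun h => hf h
  have chg : IsChain (· ≤ ·) (g '' C) := by
    rintro _ ⟨a, ha, rfl⟩ _ ⟨b, hb, rfl⟩ _
    exact (hC.total ha hb).imp (fun h => hg h) fun h => hg h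
  have hmul : #C ≤ #(f '' C) * #(g '' C) := by
    rw [Cardinal.mul_def]
    refine Cardinal.mk_le_of_injective
      (f := fun c : C => (⟨f c, c, c.2, rfl⟩, ⟨g c, c, c.2, rfl⟩)) ?_
    intro x y h
    have e1 : f x = f y := congrArg (fun p => (p.1 : A)) h
    have e2 : g x = g y := congrArg (fun p => (p.2 : B)) h
    rcases hC.total x.2 y.2 with h' | h'
    · exact Subtype.ext (hfg _ _ h' e1 e2)
    · exact Subtype.ext (hfg _ _ h' e1.symm e2.symm).symm
  have hmul' : #C ≤ Ht A * Ht B := hmul.trans (mul_le_mul' (mk_le_Ht chf) (mk_le_Ht chg))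
  have hA : 1 ≤ Ht A := one_le_Ht
  have hB : 1 ≤ Ht B := one_le_Ht
  by_cases hfin : Ht A < ℵ₀ ∧ Ht B < ℵ₀
  · have hCfin : C.Finite := Cardinal.lt_aleph0_iff_set_finite.1
      (hmul'.trans_lt (Cardinal.mul_lt_aleph0 hfin.1 hfin.2))
    rcases C.eq_empty_or_nonempty with rfl | hne
    · simpa using hA.trans (self_le_add_right _ _)
    · lift C to Finset P using hCfin
      have h := card_add_one_le_card_image f g hf hg hfg C hC (by simpa using hne)
      have h1 := mk_le_Ht chf
      have h2 := mk_le_Ht chg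
      rw [← Finset.coe_image, Finset.coe_sort_coe, Cardinal.mk_coe_finset] at h1 h2
      rw [Finset.coe_sort_coe, Cardinal.mk_coe_finset]
      refine le_trans ?_ (add_le_add h1 h2)
      exact_mod_cast h
  · have hinf : ℵ₀ ≤ Ht A + Ht B := by
      rw [not_and_or, not_lt, not_lt] at hfin
      exact hfin.elim (fun h => h.trans (self_le_add_right _ _))
        fun h => h.trans (self_le_add_left _ _)
    have hle : Ht A * Ht B ≤ Ht A + Ht B := by
      rw [not_and_or, not_lt, not_lt] at hfin
      refine (hfin.elim (fun h => Cardinal.mul_le_max_of_aleph0_le_left h)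
        fun h => Cardinal.mul_le_max_of_aleph0_le_right h).trans ?_
      exact max_le (self_le_add_right _ _) (self_le_add_left _ _)
    calc #C + 1 ≤ (Ht A + Ht B) + 1 := by gcongr; exact hmul'.trans hle
      _ = Ht A + Ht B := Cardinal.add_one_eq hinf

end Height

/-! ### Left congruences along a left ideal -/

section Ideal

variable {S : Type u} [Semigroup S]

theorem mem_iff_rel {X : Type*} {K : Set X} {r : Setoid X} (hK : K ∈ r.classes) {x y : X}
    (hx : x ∈ K) : y ∈ K ↔ r y x := by
  obtain ⟨k, rfl⟩ := hK
  exact ⟨fun hy => r.trans' hy (r.symm' hx), fun hy => r.trans' hy hx⟩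

theorem eq_or_eq_mul_of_mem {K : Set S} (hK : K ∈ (greenL S).classes) {x y : S} (hx : x ∈ K)
    (hy : y ∈ K) : y = x ∨ ∃ s, y = s * x :=
  ((mem_iff_rel hK hx).1 hy).1

theorem nonempty_of_mem_classes {X : Type*} {K : Set X} {r : Setoid X}
    (hK : K ∈ r.classes) : K.Nonempty := by
  obtain ⟨k, rfl⟩ := hK
  exact ⟨k, r.refl' k⟩

/-- `S` acts on an `L`-class `K` by partial maps: `s` is defined at `x` when `s * x ∈ K`. A
partial congruence on `K` is an equivalence that respects both the action and its domains: it is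
the same thing as a congruence, other than the universal one, on the act `K ∪ {0}`. -/
def IsPartialCong (K : Set S) (σ : Setoid K) : Prop :=
  ∀ (s : S) (x y : K), σ x y → ∀ hx : s * (x : S) ∈ K,
    ∃ hy : s * (y : S) ∈ K, σ ⟨s * x, hx⟩ ⟨s * y, hy⟩

/-- The poset of partial congruences on `K`, ordered by inclusion. -/
abbrev PartialCong (K : Set S) : Type u := {σ : Setoid K // IsPartialCong K σ}

/-- The equality relation as a partial congruence. -/
def PartialCong.bot (K : Set S) : PartialCong K :=
  ⟨⊥, fun s x y h hx => by obtain rfl : x = y := h; exact ⟨hx, rfl⟩⟩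

instance (K : Set S) : Nonempty (PartialCong K) := ⟨PartialCong.bot K⟩

/-- The left congruences on `S` that are trivial outside `I`. When `I` is a left ideal, these
correspond to the congruences on the act `I`. -/
abbrev LCongOn (I : Set S) : Type u :=
  {σ : Setoid S // IsLeftCong σ ∧ ∀ x y, σ x y → x = y ∨ x ∈ I ∧ y ∈ I}

instance (I : Set S) : Nonempty (LCongOn I) :=
  ⟨⟨⊥, fun _ _ _ h => congrArg _ h, fun _ _ h => Or.inl h⟩⟩

/-- `I` is closed under left multiplication; the empty set is allowed. -/
def IsLeftIdeal (I : Set S) : Prop := ∀ s : S, ∀ x ∈ I, s * x ∈ I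

/-- The part of `σ` inside `I`, made trivial outside `I`. -/
def cutSetoid (I : Set S) (σ : Setoid S) : Setoid S where
  r x y := x = y ∨ x ∈ I ∧ y ∈ I ∧ σ x y
  iseqv := by
    refine ⟨fun x => Or.inl rfl, ?_, ?_⟩
    · rintro x y (rfl | ⟨hx, hy, h⟩)
      · exact Or.inl rfl
      · exact Or.inr ⟨hy, hx, σ.symm' h⟩
    · rintro x y z (rfl | ⟨hx, hy, h⟩) (rfl | ⟨hy', hz, h'⟩)
      · exact Or.inl rfl
      · exact Or.inr ⟨hy', hz, h'⟩
      · exact Or.inr ⟨hx, hy, h⟩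
      · exact Or.inr ⟨hx, hz, σ.trans' h h'⟩

/-- The relation which identifies all of `I`, agrees with `ρ` on `K`, and is trivial
elsewhere. -/
def glueSetoid {I K : Set S} (hIK : Disjoint I K) (ρ : Setoid K) : Setoid S where
  r x y := x = y ∨ (x ∈ I ∧ y ∈ I) ∨ ∃ (hx : x ∈ K) (hy : y ∈ K), ρ ⟨x, hx⟩ ⟨y, hy⟩
  iseqv := by
    have hd : ∀ {x}, x ∈ I → x ∈ K → False := fun h h' => Set.disjoint_left.1 hIK h h'
    refine ⟨fun x => Or.inl rfl, ?_, ?_⟩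
    · rintro x y (rfl | ⟨hx, hy⟩ | ⟨hx, hy, h⟩)
      · exact Or.inl rfl
      · exact Or.inr (Or.inl ⟨hy, hx⟩)
      · exact Or.inr (Or.inr ⟨hy, hx, ρ.symm' h⟩)
    · rintro x y z (rfl | ⟨hx, hy⟩ | ⟨hx, hy, h⟩) h2
      · exact h2
      · rcases h2 with rfl | ⟨_, hz⟩ | ⟨hy', _, _⟩
        · exact Or.inr (Or.inl ⟨hx, hy⟩)
        · exact Or.inr (Or.inl ⟨hx, hz⟩)
        · exact (hd hy hy').elim
      · rcases h2 with rfl | ⟨hy', _⟩ | ⟨_, hz, h'⟩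
        · exact Or.inr (Or.inr ⟨hx, hy, h⟩)
        · exact (hd hy' hy).elim
        · exact Or.inr (Or.inr ⟨hx, hz, ρ.trans' h h'⟩)

variable {I K : Set S}

/-- The meet of a left congruence with the Rees congruence of the left ideal `I`. -/
def LCongOn.cutTo (hI : IsLeftIdeal I) {J : Set S} (σ : LCongOn J) : LCongOn I :=
  ⟨cutSetoid I σ.1, by
    rintro a x y (rfl | ⟨hx, hy, h⟩)
    · exact Or.inl rfl
    · exact Or.inr ⟨hI a x hx, hI a y hy, σ.2.1 a x y h⟩,
  fun x y h => h.imp id fun h => ⟨h.1, h.2.1⟩⟩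

/-- The inclusion of the left congruences that are trivial outside a smaller set. -/
def LCongOn.ofSubset {J : Set S} (hIJ : I ⊆ J) (σ : LCongOn I) : LCongOn J :=
  ⟨σ.1, σ.2.1, fun x y h => (σ.2.2 x y h).imp id fun h => ⟨hIJ h.1, hIJ h.2⟩⟩

/-- The Rees congruence of a left ideal. -/
def LCongOn.rees (hI : IsLeftIdeal I) : LCongOn I :=
  ⟨cutSetoid I ⊤, by
    rintro a x y (rfl | ⟨hx, hy, h⟩)
    · exact Or.inl rfl
    · exact Or.inr ⟨hI a x hx, hI a y hy, trivial⟩,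
  fun x y h => h.imp id fun h => ⟨h.1, h.2.1⟩⟩

theorem LCongOn.le_rees (hI : IsLeftIdeal I) (σ : LCongOn I) : σ ≤ LCongOn.rees hI := by
  intro x y h
  exact (σ.2.2 x y h).imp id fun h => ⟨h.1, h.2, trivial⟩

/-- The gluing of a partial congruence on `K` to the Rees congruence of `I` is again a left
congruence: translates of elements of `K` stay in `K` or fall into `I`, and related elements do
so together. -/
def LCongOn.glue (hI : IsLeftIdeal I) (hJ : IsLeftIdeal (I ∪ K)) (hIK : Disjoint I K)
    (ρ : PartialCong K) : LCongOn (I ∪ K) :=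
  ⟨glueSetoid hIK ρ.1, by
    rintro a x y (rfl | ⟨hx, hy⟩ | ⟨hx, hy, h⟩)
    · exact Or.inl rfl
    · exact Or.inr (Or.inl ⟨hI a x hx, hI a y hy⟩)
    · by_cases hax : a * x ∈ K
      · obtain ⟨hay, h'⟩ := ρ.2 a _ _ h hax
        exact Or.inr (Or.inr ⟨hax, hay, h'⟩)
      · have hay : a * y ∉ K := fun hay => hax (ρ.2 a _ _ (ρ.1.symm' h) hay).1
        exact Or.inr (Or.inl ⟨(hJ a x (Or.inr hx)).resolve_right hax,
          (hJ a y (Or.inr hy)).resolve_right hay⟩),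
  fun x y h => h.imp id fun h => h.elim (fun h => ⟨Or.inl h.1, Or.inl h.2⟩)
    fun ⟨hx, hy, _⟩ => ⟨Or.inr hx, Or.inr hy⟩⟩

/-- If no element of `K` is related to an element of the ideal `I`, then a left congruence
restricts to a partial congruence on `K`. -/
def LCongOn.restrict (hJ : IsLeftIdeal (I ∪ K)) (σ : LCongOn (I ∪ K))
    (h : ¬ ∃ x ∈ K, ∃ a ∈ I, σ.1 x a) : PartialCong K :=
  ⟨σ.1.comap Subtype.val, fun s x y hxy hx => by
    have h1 : σ.1 (s * x) (s * y) := σ.2.1 s x y hxy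
    refine ⟨(hJ s y (Or.inr y.2)).resolve_left fun hy => h ⟨_, hx, _, hy, h1⟩, h1⟩⟩

open Classical in
/-- The restriction of `σ` to `K`, where `⊤` stands for the case that `σ` relates `K` to the
ideal `I`. -/
noncomputable def LCongOn.restrictTop (hJ : IsLeftIdeal (I ∪ K)) (σ : LCongOn (I ∪ K)) :
    WithTop (PartialCong K) :=
  if h : ∃ x ∈ K, ∃ a ∈ I, σ.1 x a then ⊤ else (LCongOn.restrict hJ σ h : PartialCong K)

theorem LCongOn.exists_rel_of_exists_rel (hK : K ∈ (greenL S).classes) (hI : IsLeftIdeal I)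
    {σ : LCongOn (I ∪ K)} (h : ∃ x ∈ K, ∃ a ∈ I, σ.1 x a) {y : S} (hy : y ∈ K) :
    ∃ a ∈ I, σ.1 y a := by
  obtain ⟨x, hx, a, ha, hxa⟩ := h
  rcases eq_or_eq_mul_of_mem hK hx hy with rfl | ⟨s, rfl⟩
  · exact ⟨a, ha, hxa⟩
  · exact ⟨s * a, hI s a ha, σ.2.1 s x a hxa⟩

theorem LCongOn.restrictTop_mono (hJ : IsLeftIdeal (I ∪ K)) :
    Monotone (LCongOn.restrictTop hJ) := by
  intro σ τ h
  unfold LCongOn.restrictTop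
  by_cases hτ : ∃ x ∈ K, ∃ a ∈ I, τ.1 x a
  · rw [dif_pos hτ]; exact le_top
  · have hσ : ¬ ∃ x ∈ K, ∃ a ∈ I, σ.1 x a := fun ⟨x, hx, a, ha, hxa⟩ =>
      hτ ⟨x, hx, a, ha, h hxa⟩
    rw [dif_neg hτ, dif_neg hσ, WithTop.coe_le_coe]
    intro x y hxy
    exact h hxy

/-- A left congruence that is trivial outside `I ∪ K` is determined, among those comparable to
it, by its part in `I` and its restriction to `K`. This is the diamond lemma for the Rees
congruence of `I`. -/
theorem LCongOn.eq_of_cutTo_eq_of_restrictTop_eq (hK : K ∈ (greenL S).classes)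
    (hI : IsLeftIdeal I) (hJ : IsLeftIdeal (I ∪ K)) {σ τ : LCongOn (I ∪ K)} (hle : σ ≤ τ)
    (h1 : LCongOn.cutTo hI σ = LCongOn.cutTo hI τ)
    (h2 : LCongOn.restrictTop hJ σ = LCongOn.restrictTop hJ τ) : σ = τ := by
  have hin : ∀ x ∈ I, ∀ y ∈ I, τ.1 x y → σ.1 x y := by
    intro x hx y hy h
    have h3 : (LCongOn.cutTo hI τ).1 x y := Or.inr ⟨hx, hy, h⟩
    rw [← h1] at h3
    rcases h3 with rfl | ⟨_, _, h3⟩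
    · exact σ.1.refl' x
    · exact h3
  have hmix : (∃ x ∈ K, ∃ a ∈ I, τ.1 x a) → ∃ x ∈ K, ∃ a ∈ I, σ.1 x a := by
    intro hτ
    by_contra hσ
    unfold LCongOn.restrictTop at h2
    rw [dif_pos hτ, dif_neg hσ] at h2
    exact WithTop.coe_ne_top h2
  have hall : (∃ x ∈ K, ∃ a ∈ I, τ.1 x a) → ∀ x ∈ I ∪ K, ∃ a ∈ I, σ.1 x a := by
    rintro hτ x (hx | hx)
    · exact ⟨x, hx, σ.1.refl' x⟩
    · exact LCongOn.exists_rel_of_exists_rel hK hI (hmix hτ) hx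
  refine le_antisymm hle fun {x y} hxy => ?_
  rcases τ.2.2 x y hxy with rfl | ⟨hx, hy⟩
  · exact σ.1.refl' x
  by_cases hτ : ∃ x ∈ K, ∃ a ∈ I, τ.1 x a
  · obtain ⟨a, ha, hxa⟩ := hall hτ x hx
    obtain ⟨b, hb, hyb⟩ := hall hτ y hy
    have hab : σ.1 a b := hin a ha b hb
      (τ.1.trans' (τ.1.symm' (hle hxa)) (τ.1.trans' hxy (hle hyb)))
    exact σ.1.trans' hxa (σ.1.trans' hab (σ.1.symm' hyb))
  · have hσ : ¬ ∃ x ∈ K, ∃ a ∈ I, σ.1 x a := fun ⟨x, hx, a, ha, hxa⟩ =>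
      hτ ⟨x, hx, a, ha, hle hxa⟩
    rcases hx with hx | hx <;> rcases hy with hy | hy
    · exact hin x hx y hy hxy
    · exact (hτ ⟨y, hy, x, hx, τ.1.symm' hxy⟩).elim
    · exact (hτ ⟨x, hx, y, hy, hxy⟩).elim
    · unfold LCongOn.restrictTop at h2
      rw [dif_neg hτ, dif_neg hσ, WithTop.coe_inj] at h2
      have h3 : (LCongOn.restrict hJ τ hτ).1 ⟨x, hx⟩ ⟨y, hy⟩ := hxy
      rw [← h2] at h3
      exact h3

theorem LCongOn.Ht_union_le (hK : K ∈ (greenL S).classes)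
    (hI : IsLeftIdeal I) (hJ : IsLeftIdeal (I ∪ K)) :
    Ht (LCongOn (I ∪ K)) ≤ Ht (LCongOn I) + Ht (PartialCong K) := by
  have h := Ht_add_one_le_of_separating (LCongOn.cutTo hI (J := I ∪ K)) (LCongOn.restrictTop hJ)
    (fun σ τ h x y hxy => hxy.imp id fun hxy => ⟨hxy.1, hxy.2.1, h hxy.2.2⟩)
    (LCongOn.restrictTop_mono hJ)
    (fun σ τ h h1 h2 => LCongOn.eq_of_cutTo_eq_of_restrictTop_eq hK hI hJ h h1 h2)
  rw [Ht_withTop, ← add_assoc, Cardinal.add_one_le_add_one_iff] at h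
  exact h

theorem LCongOn.glue_ne_rees (hK : K.Nonempty) (hne : I.Nonempty) (hI : IsLeftIdeal I)
    (hJ : IsLeftIdeal (I ∪ K)) (hIK : Disjoint I K) (ρ : PartialCong K) :
    LCongOn.glue hI hJ hIK ρ ≠ LCongOn.rees hJ := by
  intro h
  obtain ⟨x, hx⟩ := hK
  obtain ⟨a, ha⟩ := hne
  have h1 : (LCongOn.rees hJ).1 x a := Or.inr ⟨Or.inr hx, Or.inl ha, trivial⟩
  rw [← h] at h1
  rcases h1 with rfl | ⟨hx', _⟩ | ⟨_, ha', _⟩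
  · exact Set.disjoint_left.1 hIK ha hx
  · exact Set.disjoint_left.1 hIK hx' hx
  · exact Set.disjoint_left.1 hIK ha ha'

theorem LCongOn.glue_le_glue (hI : IsLeftIdeal I) (hJ : IsLeftIdeal (I ∪ K))
    (hIK : Disjoint I K) {ρ ρ' : PartialCong K} (h : ρ ≤ ρ') :
    LCongOn.glue hI hJ hIK ρ ≤ LCongOn.glue hI hJ hIK ρ' :=
  fun {_ _} hxy => hxy.imp id fun hxy => hxy.imp id fun ⟨hx, hy, hxy⟩ => ⟨hx, hy, h hxy⟩

theorem LCongOn.glue_rel (hI : IsLeftIdeal I) (hJ : IsLeftIdeal (I ∪ K))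
    (hIK : Disjoint I K) (ρ : PartialCong K) (x y : K) :
    (LCongOn.glue hI hJ hIK ρ).1 x y ↔ ρ.1 x y := by
  constructor
  · rintro (h | ⟨hx', _⟩ | ⟨_, _, h⟩)
    · rw [Subtype.ext h]
    · exact (Set.disjoint_left.1 hIK hx' x.2).elim
    · exact h
  · exact fun h => Or.inr (Or.inr ⟨x.2, y.2, h⟩)

theorem LCongOn.ofSubset_le_glue (hI : IsLeftIdeal I) (hJ : IsLeftIdeal (I ∪ K))
    (hIK : Disjoint I K) (σ : LCongOn I) (ρ : PartialCong K) :
    LCongOn.ofSubset Set.subset_union_left σ ≤ LCongOn.glue hI hJ hIK ρ :=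
  fun {x y} hxy => (σ.2.2 x y hxy).imp id Or.inl

open Classical in
/-- The lower bound: a chain of left congruences on `I` is continued by the congruences that
collapse `I` and agree with a member of a chain on `K`. The equality relation on `K`, whose
continuation might repeat the Rees congruence of `I`, is sent to that of `I ∪ K` instead. -/
theorem LCongOn.le_Ht_union (hK : K.Nonempty) (hne : I.Nonempty) (hI : IsLeftIdeal I)
    (hJ : IsLeftIdeal (I ∪ K)) (hIK : Disjoint I K) :
    Ht (LCongOn I) + Ht (PartialCong K) ≤ Ht (LCongOn (I ∪ K)) := by
  refine Ht_add_Ht_le fun C D hC hD => ?_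
  have hbot : ∀ (σ : LCongOn I) (ρ : PartialCong K), ρ ≠ PartialCong.bot K →
      LCongOn.ofSubset Set.subset_union_left σ ≠ LCongOn.glue hI hJ hIK ρ := by
    intro σ ρ hρ h
    apply hρ
    apply Subtype.ext
    refine le_antisymm (fun {x y} hxy => ?_) bot_le
    have h1 := (LCongOn.glue_rel hI hJ hIK ρ x y).2 hxy
    rw [← h] at h1
    rcases σ.2.2 x y h1 with h2 | ⟨h2, _⟩
    · exact Subtype.ext h2
    · exact (Set.disjoint_left.1 hIK h2 x.2).elim
  have htop : ∀ σ : LCongOn I,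
      LCongOn.ofSubset Set.subset_union_left σ ≠ LCongOn.rees hJ := fun σ h => by
    refine LCongOn.glue_ne_rees hK hne hI hJ hIK (PartialCong.bot K)
      (le_antisymm (LCongOn.le_rees hJ _) ?_)
    rw [← h]
    exact LCongOn.ofSubset_le_glue hI hJ hIK σ _
  let G : PartialCong K → LCongOn (I ∪ K) := fun ρ =>
    if ρ = PartialCong.bot K then LCongOn.rees hJ else LCongOn.glue hI hJ hIK ρ
  have hG1 : ∀ ρ, ρ = PartialCong.bot K → G ρ = LCongOn.rees hJ := fun ρ h => if_pos h
  have hG2 : ∀ ρ, ρ ≠ PartialCong.bot K → G ρ = LCongOn.glue hI hJ hIK ρ := fun ρ h => if_neg h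
  have hσG : ∀ (σ : LCongOn I) (ρ : PartialCong K),
      LCongOn.ofSubset Set.subset_union_left σ ≠ G ρ := by
    intro σ ρ
    by_cases hρ : ρ = PartialCong.bot K
    · rw [hG1 ρ hρ]; exact htop σ
    · rw [hG2 ρ hρ]; exact hbot σ ρ hρ
  have hσG' : ∀ (σ : LCongOn I) (ρ : PartialCong K),
      LCongOn.ofSubset Set.subset_union_left σ ≤ G ρ := by
    intro σ ρ
    by_cases hρ : ρ = PartialCong.bot K
    · rw [hG1 ρ hρ]; exact LCongOn.le_rees hJ _
    · rw [hG2 ρ hρ]; exact LCongOn.ofSubset_le_glue hI hJ hIK σ ρ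
  rw [Cardinal.add_def]
  refine mk_le_Ht_of_injective (α := C ⊕ D) (Sum.elim
    (fun σ => LCongOn.ofSubset Set.subset_union_left σ.1) fun ρ => G ρ.1) ?_ ?_
  · rintro (σ | ρ) (σ' | ρ') h
    · refine congrArg Sum.inl (Subtype.ext (Subtype.ext ?_))
      exact congrArg (fun τ : LCongOn (I ∪ K) => τ.1) h
    · exact (hσG _ _ h).elim
    · exact (hσG _ _ h.symm).elim
    · refine congrArg Sum.inr (Subtype.ext ?_)
      change G ρ.1 = G ρ'.1 at h
      by_cases h1 : ρ.1 = PartialCong.bot K <;> by_cases h2 : ρ'.1 = PartialCong.bot K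
      · rw [h1, h2]
      · rw [hG1 _ h1, hG2 _ h2] at h
        exact (LCongOn.glue_ne_rees hK hne hI hJ hIK _ h.symm).elim
      · rw [hG2 _ h1, hG1 _ h2] at h
        exact (LCongOn.glue_ne_rees hK hne hI hJ hIK _ h).elim
      · rw [hG2 _ h1, hG2 _ h2] at h
        refine Subtype.ext (Setoid.ext fun x y => ?_)
        rw [← LCongOn.glue_rel hI hJ hIK, ← LCongOn.glue_rel hI hJ hIK, h]
  · rintro (σ | ρ) (σ' | ρ')
    · exact hC.total σ.2 σ'.2
    · exact Or.inl (hσG' _ _)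
    · exact Or.inr (hσG' _ _)
    · change G ρ.1 ≤ G ρ'.1 ∨ G ρ'.1 ≤ G ρ.1
      by_cases h1 : ρ.1 = PartialCong.bot K
      · rw [hG1 _ h1]; exact Or.inr (LCongOn.le_rees hJ _)
      by_cases h2 : ρ'.1 = PartialCong.bot K
      · rw [hG1 _ h2]; exact Or.inl (LCongOn.le_rees hJ _)
      rw [hG2 _ h1, hG2 _ h2]
      exact (hD.total ρ.2 ρ'.2).imp (LCongOn.glue_le_glue hI hJ hIK)
        (LCongOn.glue_le_glue hI hJ hIK)

theorem LCongOn.Ht_union (hK : K ∈ (greenL S).classes) (hne : I.Nonempty) (hI : IsLeftIdeal I)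
    (hJ : IsLeftIdeal (I ∪ K)) (hIK : Disjoint I K) :
    Ht (LCongOn (I ∪ K)) = Ht (LCongOn I) + Ht (PartialCong K) :=
  le_antisymm (LCongOn.Ht_union_le hK hI hJ)
    (LCongOn.le_Ht_union (nonempty_of_mem_classes hK) hne hI hJ hIK)

end Ideal

/-! ### Summing over the `L`-classes -/

section Sum

variable {S : Type u} [Semigroup S] {K : Set S}

theorem IsMinimalLClass.isLeftIdeal (hK : IsMinimalLClass K) : IsLeftIdeal K :=
  fun s _ hx => (minAct K hK).smul_mem s hx

/-- On a left ideal `K`, every left congruence that is trivial outside `K` is the gluing of its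
restriction along the empty ideal. -/
def LCongOn.orderIsoPartialCong (hK : IsLeftIdeal (∅ ∪ K)) :
    LCongOn (∅ ∪ K) ≃o PartialCong K where
  toFun σ := LCongOn.restrict hK σ fun ⟨_, _, _, ha, _⟩ => ha
  invFun ρ := LCongOn.glue (fun _ _ h => h.elim) hK (Set.empty_disjoint K) ρ
  left_inv σ := by
    refine Subtype.ext (Setoid.ext fun x y => ?_)
    constructor
    · rintro (rfl | ⟨hx, _⟩ | ⟨_, _, h⟩)
      · exact σ.1.refl' _
      · exact hx.elim
      · exact h
    · intro h
      rcases σ.2.2 x y h with rfl | ⟨hx, hy⟩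
      · exact Or.inl rfl
      · rw [Set.empty_union] at hx hy
        exact Or.inr (Or.inr ⟨hx, hy, h⟩)
  right_inv ρ := by
    refine Subtype.ext (Setoid.ext fun x y => ?_)
    exact LCongOn.glue_rel (fun _ _ h => h.elim) hK (Set.empty_disjoint K) ρ x y
  map_rel_iff' {σ τ} := by
    constructor
    · intro h x y hxy
      rcases σ.2.2 x y hxy with rfl | ⟨hx, hy⟩
      · exact τ.1.refl' _
      · rw [Set.empty_union] at hx hy
        exact h (show σ.1 ((⟨x, hx⟩ : K) : S) (⟨y, hy⟩ : K) from hxy)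
    · intro h x y hxy
      exact h hxy

theorem LCongOn.Ht_of_isLeftIdeal (hK : IsLeftIdeal K) :
    Ht (LCongOn K) = Ht (PartialCong K) := by
  rw [← Set.empty_union K] at hK
  rw [← Ht_congr (LCongOn.orderIsoPartialCong hK), Set.empty_union]

/-- The condition to be trivial outside the whole of `S` is void. -/
def LCongOn.univOrderIso : LCongOn (Set.univ : Set S) ≃o LCong S where
  toFun σ := ⟨σ.1, σ.2.1⟩
  invFun σ := ⟨σ.1, σ.2, fun _ _ _ => Or.inr ⟨trivial, trivial⟩⟩
  left_inv _ := rfl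
  right_inv _ := rfl
  map_rel_iff' := Iff.rfl

/-- The principal left ideal generated by `K`. For `L`-classes, inclusion of these ideals is the
order on `L`-classes. -/
def leftIdealClosure (K : Set S) : Set S := {x | ∃ y ∈ K, leL x y}

open Classical in
/-- The ideal made up of the `L`-classes in `F` is built up from the minimal one by adding one
`L`-class at a time. -/
theorem Ht_LCongOn_biUnion {M : Set S} (hM : IsMinimalLClass M) (F : Finset (Set S))
    (hF : ∀ K ∈ F, K ∈ (greenL S).classes) (hMF : M ∈ F) (hideal : IsLeftIdeal (⋃ K ∈ F, K)) :
    Ht (LCongOn (⋃ K ∈ F, K)) = ∑ K ∈ F, Ht (PartialCong K) := by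
  induction hn : F.card generalizing F with
  | zero => simp_all
  | succ n ih =>
    rcases (F.erase M).eq_empty_or_nonempty with h0 | hne
    · obtain rfl : F = {M} := by rw [← Finset.insert_erase hMF, h0]; rfl
      rw [Finset.set_biUnion_singleton, Finset.sum_singleton]
      exact LCongOn.Ht_of_isLeftIdeal hM.isLeftIdeal
    · obtain ⟨K, hKF', hmax⟩ := (F.erase M).exists_maximalFor leftIdealClosure hne
      obtain ⟨hKM, hKF⟩ := Finset.mem_erase.1 hKF'
      have hK := hF K hKF
      set E := F.erase K with hE
      have hEF : E ⊆ F := Finset.erase_subset _ _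
      have hME : M ∈ E := Finset.mem_erase.2 ⟨hKM.symm, hMF⟩
      have hEideal : IsLeftIdeal (⋃ K ∈ E, K) := by
        intro s x hx
        obtain ⟨K₁, hK₁E, hxK₁⟩ := Set.mem_iUnion₂.1 hx
        obtain ⟨hK₁K, hK₁F⟩ := Finset.mem_erase.1 hK₁E
        obtain ⟨K₂, hK₂F, hxK₂⟩ := Set.mem_iUnion₂.1
          (hideal s x (Set.mem_iUnion₂.2 ⟨K₁, hK₁F, hxK₁⟩))
        refine Set.mem_iUnion₂.2 ⟨K₂, Finset.mem_erase.2 ⟨?_, hK₂F⟩, hxK₂⟩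
        rintro rfl
        -- Here `K₂` lies below `K₁`, so maximality of `K₂` forces the two to be equal.
        have hle : leL (s * x) x := Or.inr ⟨s, rfl⟩
        by_cases hK₁M : K₁ = M
        · subst hK₁M
          exact hKM (hM.2 _ hK ⟨_, hxK₂, x, hxK₁, hle⟩)
        · have hcl : leftIdealClosure K₂ ≤ leftIdealClosure K₁ := by
            rintro z ⟨y, hy, hzy⟩
            refine ⟨x, hxK₁, leL_trans hzy (leL_trans ?_ hle)⟩
            exact ((mem_iff_rel hK hxK₂).1 hy).1
          obtain ⟨y, hy, hxy⟩ := hmax (Finset.mem_erase.2 ⟨hK₁M, hK₁F⟩) hcl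
            ⟨x, hxK₁, leL_refl x⟩
          refine hK₁K (Setoid.eq_of_mem_classes (hF K₁ hK₁F) hxK₁ hK ((mem_iff_rel hK hxK₂).2 ?_))
          exact ⟨leL_trans hxy ((mem_iff_rel hK hxK₂).1 hy).1, hle⟩
      have hunion : (⋃ K ∈ F, K) = (⋃ K ∈ E, K) ∪ K := by
        rw [← Finset.insert_erase hKF, Finset.set_biUnion_insert, Set.union_comm]
      have hdisj : Disjoint (⋃ K ∈ E, K) K := by
        rw [Set.disjoint_left]
        intro x hx hxK
        obtain ⟨K₁, hK₁E, hxK₁⟩ := Set.mem_iUnion₂.1 hx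
        exact (Finset.mem_erase.1 hK₁E).1 (Setoid.eq_of_mem_classes (hF _ (hEF hK₁E)) hxK₁ hK hxK)
      have hnonempty : (⋃ K ∈ E, K).Nonempty := by
        obtain ⟨x, hx⟩ := nonempty_of_mem_classes hM.1
        exact ⟨x, Set.mem_iUnion₂.2 ⟨M, hME, hx⟩⟩
      rw [hunion] at hideal ⊢
      rw [LCongOn.Ht_union hK hnonempty hEideal hideal hdisj,
        ih E (fun K' h => hF K' (hEF h)) hME hEideal
          (by rw [hE, Finset.card_erase_of_mem hKF, hn]; rfl),
        Finset.sum_erase_add _ _ hKF]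

/-- The height of the lattice of left congruences is a sum of contributions of the
`L`-classes. -/
theorem Ht_LCong_eq_sum (hfin : (greenL S).classes.Finite) {M : Set S}
    (hM : IsMinimalLClass M) :
    Ht (LCong S) = ∑ K ∈ hfin.toFinset, Ht (PartialCong K) := by
  have huniv : (⋃ K ∈ hfin.toFinset, K) = Set.univ := by
    refine Set.eq_univ_of_forall fun x => Set.mem_iUnion₂.2
      ⟨_, hfin.mem_toFinset.2 ((greenL S).mem_classes x), (greenL S).refl' x⟩
  have h := Ht_LCongOn_biUnion hM hfin.toFinset (fun K hK => hfin.mem_toFinset.1 hK)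
    (hfin.mem_toFinset.2 hM.1) (by rw [huniv]; exact fun _ _ _ => trivial)
  rw [← h, huniv, Ht_congr LCongOn.univOrderIso]

end Sum

/-! ### Green's Lemma and `D`-classes -/

section Green

variable {S : Type u} [Semigroup S] {K K' : Set S}

/-- Right translations by `t` and `t'` map `K` to `K'` and back, and are mutually inverse. -/
def TransInverse (K K' : Set S) (t t' : WithOne S) : Prop :=
  (∀ x ∈ K, rmul x t ∈ K' ∧ rmul (rmul x t) t' = x) ∧
    ∀ x ∈ K', rmul x t' ∈ K ∧ rmul (rmul x t') t = x

theorem exists_eq_rmul {x y : S} (h : leR x y) : ∃ t, x = rmul y t := by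
  rcases h with rfl | ⟨s, rfl⟩
  · exact ⟨1, rfl⟩
  · exact ⟨(s : WithOne S), rfl⟩

theorem leL_rmul {x y : S} (h : leL x y) (t : WithOne S) : leL (rmul x t) (rmul y t) := by
  rcases h with rfl | ⟨s, rfl⟩
  · exact leL_refl _
  · exact Or.inr ⟨s, (mul_rmul s y t).symm⟩

theorem greenL_rmul {x y : S} (h : greenL S x y) (t : WithOne S) :
    greenL S (rmul x t) (rmul y t) :=
  ⟨leL_rmul h.1 t, leL_rmul h.2 t⟩

/-- An identity between right translations that holds at one element of an `L`-class holds at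
all of them. -/
theorem rmul_eq_of_leL {x y : S} (h : leL x y) {t t' : WithOne S} (hy : rmul y t = rmul y t') :
    rmul x t = rmul x t' := by
  rcases h with rfl | ⟨s, rfl⟩
  · exact hy
  · rw [← mul_rmul, ← mul_rmul, hy]

theorem rmul_rmul_eq_of_leL {x y : S} (h : leL x y) {t t' : WithOne S}
    (hy : rmul (rmul y t) t' = y) : rmul (rmul x t) t' = x := by
  rw [rmul_rmul] at hy ⊢
  exact rmul_eq_of_leL (t' := 1) h hy

theorem TransInverse.symm {t t' : WithOne S} (h : TransInverse K K' t t') :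
    TransInverse K' K t' t := ⟨h.2, h.1⟩

/-- Green's Lemma: a right translation that maps `x` to an `R`-related element is a bijection
between the `L`-classes of the two elements. -/
theorem transInverse_of_rmul_eq (hK : K ∈ (greenL S).classes) (hK' : K' ∈ (greenL S).classes)
    {x : S} (hx : x ∈ K) {t t' : WithOne S} (hy : rmul x t ∈ K')
    (he : rmul (rmul x t) t' = x) : TransInverse K K' t t' := by
  have he' : rmul (rmul (rmul x t) t') t = rmul x t := by rw [he]
  constructor
  · intro z hz
    have hzx := (mem_iff_rel hK hx).1 hz
    exact ⟨(mem_iff_rel hK' hy).2 (greenL_rmul hzx t), rmul_rmul_eq_of_leL hzx.1 he⟩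
  · intro z hz
    have hzy := (mem_iff_rel hK' hy).1 hz
    refine ⟨(mem_iff_rel hK hx).2 ?_, rmul_rmul_eq_of_leL hzy.1 he'⟩
    have h := greenL_rmul hzy t'
    rwa [he] at h

/-- The relation between elements whose `L`-classes are matched by right translations. It
contains `L` and `R`, and hence `D`. -/
def transSetoid (S : Type u) [Semigroup S] : Setoid S where
  r x y := ∃ t t', TransInverse {z | greenL S z x} {z | greenL S z y} t t'
  iseqv := by
    refine ⟨fun x => ⟨1, 1, fun z hz => ⟨hz, rfl⟩, fun z hz => ⟨hz, rfl⟩⟩, ?_, ?_⟩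
    · rintro x y ⟨t, t', h⟩
      exact ⟨t', t, h.symm⟩
    · rintro x y z ⟨t, t', h⟩ ⟨s, s', k⟩
      refine ⟨t * s, s' * t', fun w hw => ?_, fun w hw => ?_⟩
      · rw [← rmul_rmul, ← rmul_rmul, (k.1 _ (h.1 w hw).1).2]
        exact ⟨(k.1 _ (h.1 w hw).1).1, (h.1 w hw).2⟩
      · rw [← rmul_rmul, ← rmul_rmul, (h.2 _ (k.2 w hw).1).2]
        exact ⟨(h.2 _ (k.2 w hw).1).1, (k.2 w hw).2⟩

theorem greenD_le_transSetoid : greenD S ≤ transSetoid S := by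
  refine sup_le (fun {x y} h => ?_) fun {x y} h => ?_
  · refine ⟨1, 1, fun z hz => ⟨?_, rfl⟩, fun z hz => ⟨?_, rfl⟩⟩
    · exact (greenL S).trans' hz h
    · exact (greenL S).trans' hz ((greenL S).symm' h)
  · obtain ⟨t, rfl⟩ := exists_eq_rmul h.2
    obtain ⟨t', ht'⟩ := exists_eq_rmul h.1
    exact ⟨t, t', transInverse_of_rmul_eq ((greenL S).mem_classes _) ((greenL S).mem_classes _)
      ((greenL S).refl' x) ((greenL S).refl' _) ht'.symm⟩

theorem exists_transInverse (hK : K ∈ (greenL S).classes) (hK' : K' ∈ (greenL S).classes)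
    {D : Set S} (hD : D ∈ (greenD S).classes) (h : K ⊆ D) (h' : K' ⊆ D) :
    ∃ t t', TransInverse K K' t t' := by
  obtain ⟨x, rfl⟩ := hK
  obtain ⟨y, rfl⟩ := hK'
  obtain ⟨d, rfl⟩ := hD
  exact greenD_le_transSetoid ((greenD S).trans' (h ((greenL S).refl' x))
    ((greenD S).symm' (h' ((greenL S).refl' y))))

/-- Pulling back a partial congruence along an invertible right translation. -/
def TransInverse.comap {t t' : WithOne S} (h : TransInverse K K' t t') (ρ : PartialCong K') :
    PartialCong K :=
  ⟨ρ.1.comap fun x => ⟨rmul x t, (h.1 x x.2).1⟩, by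
    intro s x y hxy hsx
    have h1 : s * rmul (x : S) t ∈ K' := by rw [mul_rmul]; exact (h.1 _ hsx).1
    obtain ⟨h2, h3⟩ := ρ.2 s _ _ hxy h1
    have hsy : s * (y : S) ∈ K := by
      have h4 := (h.2 _ h2).1
      rwa [← mul_rmul, (h.1 y y.2).2] at h4
    refine ⟨hsy, ?_⟩
    simp only [mul_rmul] at h3
    exact h3⟩

/-- Partial congruences on two `L`-classes matched by right translations correspond, as left
and right translations commute. -/
def TransInverse.orderIso {t t' : WithOne S} (h : TransInverse K K' t t') :
    PartialCong K' ≃o PartialCong K where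
  toFun := h.comap
  invFun := h.symm.comap
  left_inv ρ := by
    refine Subtype.ext (Setoid.ext fun x y => ?_)
    change ρ.1 ⟨rmul (rmul x t') t, _⟩ ⟨rmul (rmul y t') t, _⟩ ↔ ρ.1 x y
    simp only [(h.2 _ x.2).2, (h.2 _ y.2).2]
  right_inv ρ := by
    refine Subtype.ext (Setoid.ext fun x y => ?_)
    change ρ.1 ⟨rmul (rmul x t) t', _⟩ ⟨rmul (rmul y t) t', _⟩ ↔ ρ.1 x y
    simp only [(h.1 _ x.2).2, (h.1 _ y.2).2]
  map_rel_iff' {ρ ρ'} := by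
    constructor
    · intro hle x y hxy
      have h1 : (h.comap ρ).1 ⟨rmul x t', (h.2 x x.2).1⟩ ⟨rmul y t', (h.2 y y.2).1⟩ := by
        change ρ.1 ⟨rmul (rmul x t') t, _⟩ ⟨rmul (rmul y t') t, _⟩
        simpa only [(h.2 _ x.2).2, (h.2 _ y.2).2] using hxy
      have h2 : ρ'.1 ⟨rmul (rmul x t') t, _⟩ ⟨rmul (rmul y t') t, _⟩ := hle h1
      simpa only [(h.2 _ x.2).2, (h.2 _ y.2).2] using h2
    · intro hle x y hxy
      exact hle hxy

open Classical in
/-- `L`-classes in one `D`-class contribute equally, so the sum over all `L`-classes can be taken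
over representatives of the `D`-classes. -/
theorem Ht_LCong_eq_sum_representatives (hfin : (greenL S).classes.Finite) {n : ℕ}
    (L : Fin (n + 1) → Set S) (hL : ∀ r, L r ∈ (greenL S).classes)
    (hrep : ∀ D ∈ (greenD S).classes, ∃! r, L r ⊆ D) (hmin : IsMinimalLClass (L 0)) :
    Ht (LCong S) = ∑ r, numLClasses (L r) * Ht (PartialCong (L r)) := by
  have hsub : ∀ K ∈ (greenL S).classes, ∃ D ∈ (greenD S).classes, K ⊆ D := by
    rintro _ ⟨x, rfl⟩
    refine ⟨_, (greenD S).mem_classes x, fun z hz => ?_⟩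
    exact (le_sup_left : greenL S ≤ greenD S) hz
  have hex : ∀ K ∈ (greenL S).classes, ∃ r, ∃ D ∈ (greenD S).classes, L r ⊆ D ∧ K ⊆ D := by
    intro K hK
    obtain ⟨D, hD, hKD⟩ := hsub K hK
    obtain ⟨r, hr, _⟩ := hrep D hD
    exact ⟨r, D, hD, hr, hKD⟩
  choose! f hf using hex
  have hiff : ∀ K ∈ (greenL S).classes, ∀ r,
      f K = r ↔ ∃ D ∈ (greenD S).classes, L r ⊆ D ∧ K ⊆ D := by
    intro K hK r
    refine ⟨fun h => h ▸ hf K hK, ?_⟩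
    rintro ⟨D, hD, hr, hKD⟩
    obtain ⟨D', hD', hr', hKD'⟩ := hf K hK
    obtain ⟨x, hx⟩ := nonempty_of_mem_classes hK
    obtain rfl := Setoid.eq_of_mem_classes hD (hKD hx) hD' (hKD' hx)
    exact (hrep D hD).unique hr' hr
  rw [Ht_LCong_eq_sum hfin hmin, ← Finset.sum_fiberwise hfin.toFinset f]
  refine Finset.sum_congr rfl fun r _ => ?_
  have hconst : ∀ K ∈ hfin.toFinset.filter (fun K => f K = r),
      Ht (PartialCong K) = Ht (PartialCong (L r)) := by
    intro K hK
    obtain ⟨hK1, hK2⟩ := Finset.mem_filter.1 hK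
    rw [hfin.mem_toFinset] at hK1
    obtain ⟨D, hD, hr, hKD⟩ := (hiff K hK1 r).1 hK2
    obtain ⟨t, t', h⟩ := exists_transInverse (hL r) hK1 hD hr hKD
    exact Ht_congr h.orderIso
  rw [Finset.sum_congr rfl hconst, Finset.sum_const, nsmul_eq_mul]
  congr 2
  rw [numLClasses, ← Set.ncard_coe_finset]
  congr 1
  ext K
  simp only [Finset.coe_filter, hfin.mem_toFinset, Set.mem_ofPred_eq]
  exact and_congr_right fun hK => hiff K hK r

theorem one_le_numLClasses (hfin : (greenL S).classes.Finite) (hK : K ∈ (greenL S).classes) :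
    1 ≤ numLClasses K := by
  refine (Set.ncard_pos (hfin.subset fun _ h => h.1)).2 ⟨K, hK, ?_⟩
  obtain ⟨x, rfl⟩ := hK
  have h : {z | greenL S z x} ⊆ {z | greenD S z x} := fun z hz =>
    (le_sup_left : greenL S ≤ greenD S) hz
  exact ⟨_, (greenD S).mem_classes x, h, h⟩

end Green

/-! ### Partial congruences below `H` and subgroups of the Schützenberger group -/

section Schutzenberger

variable {S : Type u} [Semigroup S] {K H : Set S}

/-- The partial congruences on `K` that are contained in Green's relation `H`. -/
abbrev PartialCongBelowH (K : Set S) : Type u :=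
  {σ : PartialCong K // σ.1 ≤ (greenH S).comap Subtype.val}

theorem leR_rmul (x : S) (t : WithOne S) : leR (rmul x t) x := by
  cases t with
  | one => exact leR_refl x
  | coe s => exact Or.inr ⟨s, rfl⟩

theorem TransInverse.greenH_rmul (hK : K ∈ (greenL S).classes) {t t' : WithOne S}
    (h : TransInverse K K t t') {x : S} (hx : x ∈ K) : greenH S (rmul x t) x := by
  refine ⟨(mem_iff_rel hK hx).1 (h.1 x hx).1, leR_rmul x t, ?_⟩
  have h1 := leR_rmul (rmul x t) t'
  rwa [(h.1 x hx).2] at h1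

theorem TransInverse.rmul_mem (hK : K ∈ (greenL S).classes) (hH : H ∈ (greenH S).classes)
    (hHK : H ⊆ K) {t t' : WithOne S} (h : TransInverse K K t t') {x : S} (hx : x ∈ H) :
    rmul x t ∈ H :=
  (mem_iff_rel hH hx).2 (h.greenH_rmul hK (hHK hx))

/-- The element of the Schützenberger group induced by an invertible translation of `K`. -/
def TransInverse.toSchutzenberger (hK : K ∈ (greenL S).classes) (hH : H ∈ (greenH S).classes)
    (hHK : H ⊆ K) {t t' : WithOne S} (h : TransInverse K K t t') : schutzenberger H hH :=
  ⟨{ toFun := fun x => ⟨rmul x t, h.rmul_mem hK hH hHK x.2⟩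
     invFun := fun x => ⟨rmul x t', h.symm.rmul_mem hK hH hHK x.2⟩
     left_inv := fun x => Subtype.ext (h.1 x (hHK x.2)).2
     right_inv := fun x => Subtype.ext (h.2 x (hHK x.2)).2 }, t, fun _ => rfl⟩

/-- The right translation by `t` induces the permutation `α` of `H`. -/
def Induces {H : Set S} {hH : H ∈ (greenH S).classes} (t : WithOne S)
    (α : schutzenberger H hH) : Prop :=
  ∀ z : H, (α.1 z : S) = rmul (z : S) t

theorem Induces.exists_transInverse (hK : K ∈ (greenL S).classes)
    {hH : H ∈ (greenH S).classes} (hHK : H ⊆ K) {t : WithOne S} {α : schutzenberger H hH}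
    (h : Induces t α) : ∃ t', TransInverse K K t t' := by
  obtain ⟨z, hz⟩ := nonempty_of_mem_classes hH
  have ht : ∀ x ∈ H, rmul x t ∈ H := fun x hx => by
    rw [← h ⟨x, hx⟩]; exact (α.1 ⟨x, hx⟩).2
  obtain ⟨t', ht'⟩ := exists_right_inverse hH ht
  exact ⟨t', transInverse_of_rmul_eq hK hK (hHK hz) (hHK (ht z hz)) (ht' z hz)⟩

theorem exists_induces_of_greenH (hK : K ∈ (greenL S).classes) (hH : H ∈ (greenH S).classes)
    (hHK : H ⊆ K) {x y : S} (hx : x ∈ K) (hy : y ∈ K) (hxy : greenH S x y) :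
    ∃ (α : schutzenberger H hH) (t : WithOne S), Induces t α ∧ y = rmul x t := by
  obtain ⟨t, rfl⟩ := exists_eq_rmul hxy.2.2
  obtain ⟨t', ht'⟩ := exists_eq_rmul hxy.2.1
  exact ⟨(transInverse_of_rmul_eq hK hK hx hy ht'.symm).toSchutzenberger hK hH hHK, t,
    fun _ => rfl, rfl⟩

/-- The Schützenberger group acts freely on `H`. -/
theorem Induces.eq_of_apply_eq {hH : H ∈ (greenH S).classes} {t s : WithOne S}
    {α β : schutzenberger H hH} (hα : Induces t α) (hβ : Induces s β) {z : H}
    (h : α.1 z = β.1 z) : α = β := by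
  refine Subtype.ext (Equiv.ext fun w => Subtype.ext ?_)
  have hwz : leL (w : S) z := ((mem_iff_rel hH z.2).1 w.2).1.1
  rw [hα w, hβ w]
  apply rmul_eq_of_leL hwz
  rw [← hα z, ← hβ z, h]

/-- The orbit relation on `K` of a subgroup of the Schützenberger group. -/
def orbitCong (hK : K ∈ (greenL S).classes) {hH : H ∈ (greenH S).classes} (hHK : H ⊆ K)
    (N : Subgroup (schutzenberger H hH)) : PartialCongBelowH K :=
  ⟨⟨{ r := fun x y => ∃ α ∈ N, ∃ t, Induces t α ∧ (y : S) = rmul (x : S) t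
      iseqv := by
        refine ⟨fun x => ⟨1, N.one_mem, 1, fun _ => rfl, rfl⟩, ?_, ?_⟩
        · rintro x y ⟨α, hα, t, ht, hy⟩
          obtain ⟨t', h⟩ := ht.exists_transInverse hK hHK
          refine ⟨α⁻¹, N.inv_mem hα, t', fun z => ?_, ?_⟩
          · have h1 := ht ((α⁻¹).1 z)
            rw [show α.1 ((α⁻¹).1 z) = z from Equiv.apply_symm_apply α.1 z] at h1
            rw [h1]
            exact (h.1 _ (hHK ((α⁻¹).1 z).2)).2.symm
          · rw [hy, (h.1 x x.2).2]
        · rintro x y z ⟨α, hα, t, ht, hy⟩ ⟨β, hβ, s, hs, hz⟩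
          refine ⟨β * α, N.mul_mem hβ hα, t * s, fun w => ?_, ?_⟩
          · rw [← rmul_rmul, ← ht w, ← hs]; rfl
          · rw [hz, hy, rmul_rmul] }, by
    rintro s x y ⟨α, hα, t, ht, hy⟩ hx
    obtain ⟨t', h⟩ := ht.exists_transInverse hK hHK
    have h1 : s * (y : S) = rmul (s * (x : S)) t := by rw [hy, mul_rmul]
    exact ⟨by rw [h1]; exact (h.1 _ hx).1, α, hα, t, ht, h1⟩⟩, by
    rintro x y ⟨α, hα, t, ht, hy⟩
    obtain ⟨t', h⟩ := ht.exists_transInverse hK hHK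
    change greenH S x y
    rw [hy]
    exact (greenH S).symm' (h.greenH_rmul hK x.2)⟩

/-- If `σ` relates one element of `K` to its image under `α`, it relates every element to its
image. -/
theorem PartialCong.rel_rmul (hK : K ∈ (greenL S).classes) (σ : PartialCong K) {t t' : WithOne S}
    (h : TransInverse K K t t') {x : K} (hx : σ.1 x ⟨rmul x t, (h.1 x x.2).1⟩) (y : K) :
    σ.1 y ⟨rmul y t, (h.1 y y.2).1⟩ := by
  obtain ⟨y, hy⟩ := y
  rcases eq_or_eq_mul_of_mem hK x.2 hy with rfl | ⟨s, rfl⟩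
  · exact hx
  · obtain ⟨_, h1⟩ := σ.2 s _ _ hx hy
    simpa only [mul_rmul] using h1

/-- The elements of the Schützenberger group that move points within `σ`-classes. -/
def stabSubgroup {hH : H ∈ (greenH S).classes} (hHK : H ⊆ K) (σ : PartialCong K) :
    Subgroup (schutzenberger H hH) where
  carrier := {α | ∀ z : H, σ.1 ⟨z, hHK z.2⟩ ⟨α.1 z, hHK (α.1 z).2⟩}
  mul_mem' {α β} hα hβ z := σ.1.trans' (hβ z) (hα (β.1 z))
  one_mem' _ := σ.1.refl' _
  inv_mem' {α} hα z := by
    have h1 := hα ((α⁻¹).1 z)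
    rw [show α.1 ((α⁻¹).1 z) = z from Equiv.apply_symm_apply α.1 z] at h1
    exact σ.1.symm' h1

theorem mem_stabSubgroup_iff (hK : K ∈ (greenL S).classes) {hH : H ∈ (greenH S).classes}
    (hHK : H ⊆ K) (σ : PartialCong K) {α : schutzenberger H hH} {t t' : WithOne S}
    (hα : Induces t α) (h : TransInverse K K t t') (x : K) :
    α ∈ stabSubgroup hHK σ ↔ σ.1 x ⟨rmul x t, (h.1 x x.2).1⟩ := by
  constructor
  · intro hmem
    obtain ⟨z, hz⟩ := nonempty_of_mem_classes hH
    have h1 := hmem ⟨z, hz⟩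
    simp only [hα ⟨z, hz⟩] at h1
    exact σ.rel_rmul hK h h1 x
  · intro hx z
    have h1 := σ.rel_rmul hK h hx ⟨z, hHK z.2⟩
    simpa only [hα z] using h1

/-- Partial congruences on an `L`-class `K` contained in `H` are the orbit relations of the
subgroups of the Schützenberger group. -/
def orbitCongOrderIso (hK : K ∈ (greenL S).classes) (hH : H ∈ (greenH S).classes)
    (hHK : H ⊆ K) : Subgroup (schutzenberger H hH) ≃o PartialCongBelowH K :=
  Equiv.toOrderIso
    { toFun := orbitCong hK hHK
      invFun := fun σ => stabSubgroup hHK σ.1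
      left_inv := by
        intro N
        ext α
        obtain ⟨t, ht⟩ : ∃ t, Induces t α := α.2
        constructor
        · intro hα
          obtain ⟨z, hz⟩ := nonempty_of_mem_classes hH
          obtain ⟨β, hβ, s, hs, h1⟩ := hα ⟨z, hz⟩
          have h2 : α = β := ht.eq_of_apply_eq hs (z := ⟨z, hz⟩)
            (Subtype.ext (h1.trans (hs ⟨z, hz⟩).symm))
          rwa [h2]
        · exact fun hα z => ⟨α, hα, t, ht, ht z⟩
      right_inv := by
        intro σ
        refine Subtype.ext (Subtype.ext (Setoid.ext fun x y => ?_))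
        constructor
        · rintro ⟨α, hα, t, ht, hy⟩
          obtain ⟨t', h⟩ := ht.exists_transInverse hK hHK
          have h1 := (mem_stabSubgroup_iff hK hHK σ.1 ht h x).1 hα
          have h2 : y = ⟨rmul x t, (h.1 x x.2).1⟩ := Subtype.ext hy
          rwa [h2]
        · intro hxy
          obtain ⟨α, t, ht, hy⟩ := exists_induces_of_greenH hK hH hHK x.2 y.2 (σ.2 hxy)
          obtain ⟨t', h⟩ := ht.exists_transInverse hK hHK
          refine ⟨α, (mem_stabSubgroup_iff hK hHK σ.1 ht h x).2 ?_, t, ht, hy⟩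
          have h2 : y = ⟨rmul x t, (h.1 x x.2).1⟩ := Subtype.ext hy
          rwa [← h2] }
    (fun N N' h x y ⟨α, hα, hx⟩ => ⟨α, h hα, hx⟩)
    (fun σ τ h α hα z => h (hα z))

theorem Ht_partialCongBelowH (hK : K ∈ (greenL S).classes) (hH : H ∈ (greenH S).classes)
    (hHK : H ⊆ K) :
    Ht (PartialCongBelowH K) = Ht (Subgroup (schutzenberger H hH)) :=
  (Ht_congr (orbitCongOrderIso hK hH hHK)).symm

theorem HSeparable.le_greenH (hsep : HSeparable K) (σ : PartialCong K) :
    σ.1 ≤ (greenH S).comap Subtype.val := by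
  intro x y hxy
  by_contra hH
  obtain ⟨s, hs | hs⟩ := hsep x x.2 y y.2 hH
  · exact hs.2 (σ.2 s _ _ hxy hs.1).1
  · exact hs.2 (σ.2 s _ _ (σ.1.symm' hxy) hs.1).1

theorem HSeparable.Ht_partialCong (hsep : HSeparable K) (hK : K ∈ (greenL S).classes)
    (hH : H ∈ (greenH S).classes) (hHK : H ⊆ K) :
    Ht (PartialCong K) = Ht (Subgroup (schutzenberger H hH)) := by
  rw [← Ht_partialCongBelowH hK hH hHK]
  exact (Ht_congr
    { toFun := fun σ => σ.1
      invFun := fun σ => ⟨σ, hsep.le_greenH σ⟩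
      left_inv := fun _ => rfl
      right_inv := fun _ => rfl
      map_rel_iff' := Iff.rfl }).symm

theorem hSeparable_of_mem_greenH_classes (hK : K ∈ (greenH S).classes) : HSeparable K :=
  fun _ hx _ hy h => (h ((mem_iff_rel hK hy).1 hx)).elim

end Schutzenberger

/-! ### The minimal `L`-class -/

section Minimal

variable {S : Type u} [Semigroup S] {K H : Set S}

/-- The action on a minimal `L`-class is total, so that partial congruences on it are
congruences. -/
def actCongOrderIso (hK : IsMinimalLClass K) : ActCong S (minAct K hK) ≃o PartialCong K where
  toFun σ := ⟨σ.1, fun s x y h _ => ⟨(minAct K hK).smul_mem s y.2, σ.2 s x y h⟩⟩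
  invFun σ := ⟨σ.1, fun s x y h => (σ.2 s x y h ((minAct K hK).smul_mem s x.2)).2⟩
  left_inv _ := rfl
  right_inv _ := rfl
  map_rel_iff' := Iff.rfl

theorem Ht_actCong_le (hK : IsMinimalLClass K) (hH : H ∈ (greenH S).classes) (hHK : H ⊆ K) :
    Ht (Subgroup (schutzenberger H hH)) ≤ Ht (ActCong S (minAct K hK)) := by
  rw [← Ht_partialCongBelowH hK.1 hH hHK, Ht_congr (actCongOrderIso hK)]
  exact Ht_le_of_orderEmbedding (OrderEmbedding.subtype _)

/-- If all congruences other than the universal one are contained in `H`, then the universal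
congruence adds one to the height of the lattice of those below `H`. -/
theorem Ht_actCong_eq_add_one (hK : IsMinimalLClass K) (hH : H ∈ (greenH S).classes)
    (hHK : H ⊆ K) (htop : restrictH K hK ≠ ⊤)
    (hle : ∀ σ : ActCong S (minAct K hK), σ.1 ≠ ⊤ → σ.1 ≤ restrictH K hK) :
    Ht (ActCong S (minAct K hK)) = Ht (Subgroup (schutzenberger H hH)) + 1 := by
  rw [← Ht_partialCongBelowH hK.1 hH hHK, Ht_congr (actCongOrderIso hK)]
  refine Ht_eq_add_one (OrderEmbedding.subtype _)
    (actCongOrderIso hK ⟨⊤, fun _ _ _ _ => trivial⟩) (fun σ => ?_) (fun σ h => ?_) fun σ h => ?_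
  · exact (le_top : σ.1 ≤ ⊤)
  · apply htop
    rw [eq_top_iff]
    exact (congrArg (fun τ : PartialCong K => τ.1) h).symm.le.trans σ.2
  · refine ⟨⟨σ, hle ((actCongOrderIso hK).symm σ) fun h' => h ?_⟩, rfl⟩
    exact Subtype.ext h'

/-- If the congruences contained in `H` have finite height and `H` is the only maximal
congruence, then every congruence other than the universal one is contained in `H`. Otherwise
Zorn's lemma would give a maximal one among the congruences that extend a given `σ` not below
`H` and do not contain `H`. -/
theorem le_restrictH_of_finite (hK : IsMinimalLClass K) (hH : H ∈ (greenH S).classes)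
    (hHK : H ⊆ K) (hmax : RestrictHUniqueMaximal K hK)
    (hfin : Ht (Subgroup (schutzenberger H hH)) < ℵ₀) (σ : ActCong S (minAct K hK))
    (hσ : σ.1 ≠ ⊤) : σ.1 ≤ restrictH K hK := by
  by_contra hσH
  obtain ⟨⟨hHcong, hHtop, hHmax⟩, huniq⟩ := hmax
  -- As `H` is maximal, a congruence above `σ` is proper if and only if it does not contain `H`.
  have htop : ∀ τ : ActCong S (minAct K hK), σ ≤ τ → restrictH K hK ≤ τ.1 → τ.1 = ⊤ := by
    intro τ hστ hHτ
    by_contra hτ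
    exact hHmax ⟨τ.1, τ.2, lt_of_le_not_ge hHτ fun h => hσH (le_trans hστ h),
      lt_top_iff_ne_top.2 hτ⟩
  have hσ' : ¬ restrictH K hK ≤ σ.1 := fun h => hσ (htop σ le_rfl h)
  have hchains : ∀ c ⊆ {τ : ActCong S (minAct K hK) | σ ≤ τ ∧ ¬ restrictH K hK ≤ τ.1},
      IsChain (· ≤ ·) c → ∀ y ∈ c,
        ∃ ub ∈ {τ : ActCong S (minAct K hK) | σ ≤ τ ∧ ¬ restrictH K hK ≤ τ.1},
          ∀ z ∈ c, z ≤ ub := by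
    intro c hc hchain y hy
    -- The traces of the members of `c` on `H` form a finite chain, so one of them is greatest.
    let f : ActCong S (minAct K hK) → PartialCongBelowH K := fun τ =>
      ⟨actCongOrderIso hK ⟨τ.1 ⊓ restrictH K hK, fun s x y h =>
        ⟨τ.2 s x y h.1, hHcong s x y h.2⟩⟩, inf_le_right (a := τ.1)⟩
    have hf : Monotone f := fun τ τ' h => inf_le_inf_right (restrictH K hK) h
    have hfc : IsChain (· ≤ ·) (f '' c) := by
      rintro _ ⟨a, ha, rfl⟩ _ ⟨b, hb, rfl⟩ _
      exact (hchain.total ha hb).imp (fun h => hf h) fun h => hf h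
    have hffin : (f '' c).Finite := by
      rw [← Cardinal.lt_aleph0_iff_set_finite]
      refine (mk_le_Ht hfc).trans_lt ?_
      rwa [Ht_partialCongBelowH hK.1 hH hHK]
    obtain ⟨_, ⟨τ, hτc, rfl⟩, hτ⟩ := hffin.exists_maximal ⟨_, y, hy, rfl⟩
    have hτmax : ∀ τ' ∈ c, f τ' ≤ f τ := fun τ' h =>
      (hfc.total ⟨τ', h, rfl⟩ ⟨τ, hτc, rfl⟩).elim id fun h' => hτ ⟨τ', h, rfl⟩ h'
    let U : ActCong S (minAct K hK) :=
      ⟨{ r := fun a b => ∃ τ ∈ c, τ.1 a b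
         iseqv := by
          refine ⟨fun a => ⟨y, hy, y.1.refl' a⟩, ?_, ?_⟩
          · rintro a b ⟨τ, hτ, h⟩
            exact ⟨τ, hτ, τ.1.symm' h⟩
          · rintro a b d ⟨τ, hτ, h⟩ ⟨τ', hτ', h'⟩
            rcases hchain.total hτ hτ' with hle | hle
            · exact ⟨τ', hτ', τ'.1.trans' (hle h) h'⟩
            · exact ⟨τ, hτ, τ.1.trans' h (hle h')⟩ },
        fun s a b ⟨τ, hτ, h⟩ => ⟨τ, hτ, τ.2 s a b h⟩⟩
    have hU : ∀ τ ∈ c, τ ≤ U := fun τ hτ a b h => ⟨τ, hτ, h⟩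
    refine ⟨U, ⟨le_trans (hc hy).1 (hU y hy), fun hHU => (hc hτc).2 ?_⟩, hU⟩
    intro a b hab
    obtain ⟨τ', hτ', h⟩ := hHU hab
    have h1 : (f τ').1.1 a b := ⟨h, hab⟩
    have h2 : (f τ).1.1 a b := hτmax τ' hτ' h1
    exact h2.1
  obtain ⟨m, hσm, hm⟩ := zorn_le_nonempty₀ _ hchains σ ⟨le_rfl, hσ'⟩
  have hmtop : m.1 ≠ ⊤ := fun h => hm.prop.2 (h ▸ le_top)
  have hm' : IsMaximalActCong S m.1 := by
    refine ⟨m.2, hmtop, ?_⟩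
    rintro ⟨τ, hτ, hmτ, hτtop⟩
    by_cases hHτ : restrictH K hK ≤ τ
    · exact hτtop.ne (htop ⟨τ, hτ⟩ (le_trans hσm hmτ.le) hHτ)
    · exact hmτ.not_ge (hm.le_of_ge (y := ⟨τ, hτ⟩) ⟨le_trans hσm hmτ.le, hHτ⟩ hmτ.le)
  exact hm.prop.2 (huniq _ hm').ge

end Minimal

end SgpHeight

open SgpHeight
theorem mainTheorem4 {S : Type*} [Semigroup S]
    (hfin : (greenL S).classes.Finite)
    (n : ℕ) (L : Fin (n + 1) → Set S)
    (hL : ∀ r, L r ∈ (greenL S).classes)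
    (hrep : ∀ D ∈ (greenD S).classes, ∃! r, L r ⊆ D)
    (hmin : IsMinimalLClass (L 0))
    (H : Fin (n + 1) → Set S)
    (hH : ∀ r, H r ∈ (greenH S).classes)
    (hHL : ∀ r, H r ⊆ L r)
    (hsep : ∀ r, r ≠ 0 → HSeparable (L r)) :
    -- the general formula
    Ht (LCong S) =
        numLClasses (L 0) * Ht (ActCong S (minAct (L 0) hmin)) +
          ∑ r : Fin n, numLClasses (L r.succ) * Ht (Subgroup (schutzenberger (H r.succ) (hH r.succ)))
    ∧
    -- the case in which the minimal class is an `H`-class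
    (L 0 ∈ (greenH S).classes →
      Ht (LCong S) =
        ∑ r : Fin (n + 1), numLClasses (L r) * Ht (Subgroup (schutzenberger (H r) (hH r))))
    ∧
    -- the case in which `H` restricts to the unique maximal congruence on the minimal class
    (RestrictHUniqueMaximal (L 0) hmin →
      Cardinal.toENat (Ht (LCong S)) =
          Cardinal.toENat (numLClasses (L 0) +
            ∑ r : Fin (n + 1), numLClasses (L r) * Ht (Subgroup (schutzenberger (H r) (hH r))))
      ∧
      ((Ht (Subgroup (schutzenberger (H 0) (hH 0))) < Cardinal.aleph0 ∨
          ∀ σ : ActCong S (minAct (L 0) hmin), σ.1 ≠ ⊤ → σ.1 ≤ restrictH (L 0) hmin) →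
        Ht (LCong S) =
          numLClasses (L 0) +
            ∑ r : Fin (n + 1), numLClasses (L r) * Ht (Subgroup (schutzenberger (H r) (hH r))))) := by
  have hsum := Ht_LCong_eq_sum_representatives hfin L hL hrep hmin
  have hsucc : ∀ r : Fin n, Ht (PartialCong (L r.succ)) =
      Ht (Subgroup (schutzenberger (H r.succ) (hH r.succ))) := fun r =>
    (hsep r.succ r.succ_ne_zero).Ht_partialCong (hL _) (hH _) (hHL _)
  have hgen : Ht (LCong S) = numLClasses (L 0) * Ht (ActCong S (minAct (L 0) hmin)) +
      ∑ r : Fin n, numLClasses (L r.succ) *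
        Ht (Subgroup (schutzenberger (H r.succ) (hH r.succ))) := by
    rw [hsum, Fin.sum_univ_succ, Ht_congr (actCongOrderIso hmin)]
    simp only [hsucc]
  refine ⟨hgen, fun h0 => ?_, fun hmax => ?_⟩
  · rw [hsum, Fin.sum_univ_succ, Fin.sum_univ_succ]
    simp only [hsucc]
    rw [(hSeparable_of_mem_greenH_classes h0).Ht_partialCong (hL 0) (hH 0) (hHL 0)]
  · have hadd : Ht (ActCong S (minAct (L 0) hmin)) =
          Ht (Subgroup (schutzenberger (H 0) (hH 0))) + 1 →
        Ht (LCong S) = numLClasses (L 0) + ∑ r : Fin (n + 1), numLClasses (L r) *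
          Ht (Subgroup (schutzenberger (H r) (hH r))) := by
      intro h
      rw [hgen, h, Fin.sum_univ_succ, mul_add, mul_one, add_right_comm, add_comm]
    have hfinite : Ht (Subgroup (schutzenberger (H 0) (hH 0))) < ℵ₀ →
        Ht (ActCong S (minAct (L 0) hmin)) =
          Ht (Subgroup (schutzenberger (H 0) (hH 0))) + 1 := fun h =>
      Ht_actCong_eq_add_one hmin (hH 0) (hHL 0) hmax.1.2.1
        (le_restrictH_of_finite hmin (hH 0) (hHL 0) hmax h)
    refine ⟨?_, fun h => hadd (h.elim hfinite
      (Ht_actCong_eq_add_one hmin (hH 0) (hHL 0) hmax.1.2.1))⟩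
    rcases lt_or_ge (Ht (Subgroup (schutzenberger (H 0) (hH 0)))) ℵ₀ with h | h
    · rw [hadd (hfinite h)]
    · have hm : (1 : Cardinal) ≤ numLClasses (L 0) := by
        exact_mod_cast one_le_numLClasses hfin (hL 0)
      have hle : ∀ {a b c : Cardinal}, ℵ₀ ≤ b → 1 ≤ a → ℵ₀ ≤ a * b + c := fun hb ha =>
        (hb.trans (by simpa using mul_le_mul_left ha _)).trans (self_le_add_right _ _)
      -- Both sides are infinite.
      rw [hgen, Fin.sum_univ_succ, Cardinal.toENat_eq_top.2, Cardinal.toENat_eq_top.2]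
      · exact (hle h hm).trans (self_le_add_left _ _)
      · exact hle (h.trans (Ht_actCong_le hmin (hH 0) (hHL 0))) hm
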